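/- Conventions. All Hilbert spaces are complex. A unital operator space is a complex vector space $V$ with a norm on each $M_n(V)$ and a distinguished element $e$ for which there are a Hilbert space $K$ and a linear map $j\colon V\to B(K)$ with $j(e)=1$ such that every amplification $j_n=\mathrm{id}_n\otimes j\colon M_n(V)\to M_n(B(K))=B(K^n)$ is isometric. A linear map $\phi$ between unital operator spaces is ucc (ucis) if it preserves the units and all its amplifications $\phi_n$ are contractive (isometric). A unital operator space $E$ is injective if for all unital operator spaces $Z\subseteq Y$ (with the same unit and the inherited matrix norms), every ucc map $Z\to E$ extends to a ucc map $Y\to E$. An extension of $X$ is a pair $(E,\iota)$ with $E$ a unital operator space and $\iota\colon X\to E$ a ucis map. It is rigid if $\mathrm{id}_E$ is the only ucc map $\phi\colon E\to E$ with $\phi\circ\iota=\iota$. It is an injective envelope of $X$ if $E$ is injective and no proper linear subspace of $E$ that contains $\iota(X)$ is injective. Let $H$ be a Hilbert space and $X\subseteq B(H)$ a linear subspace with $1\in X$. For a linear subspace $\mathcal I\subseteq B(H)$ let $q_{\mathcal I}\colon B(H)\to B(H)/\mathcal I$ be the quotient map and put on the quotient the unit $q_{\mathcal I}(1)$ and the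 matrix (semi)norms $$\|[x_{ij}+\mathcal I]\|_n=\inf\{\|[x_{ij}+y_{ij}]\|_n : y_{ij}\in\mathcal I\}.$$ A boundary subsystem for $X$ in $B(H)$ is a selfadjoint linear subspace $\mathcal I\subseteq B(H)$ such that $q_{\mathcal I}|_X$ is completely isometric; it is maximal if it is maximal with respect to inclusion among the boundary subsystems for $X$ in $B(H)$. Theorem. There is a maximal boundary subsystem for $X$ in $B(H)$. If $\mathcal I$ is any maximal boundary subsystem for $X$ in $B(H)$, then $(B(H)/\mathcal I,\ q_{\mathcal I}|_X)$ is an injective envelope of $X$, and it is a rigid extension of $X$. (In particular, $X$ has an injective envelope.) -/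

import Mathlib

universe u

/-- The operator on the Hilbert space `H ⊕ ⋯ ⊕ H` (`n` copies) given by an `n × n` matrix of bounded
operators on `H`: the `i`-th coordinate of the image of `v` is `∑ j, T i j (v j)`. -/
noncomputable def blockOp {H : Type*} [NormedAddCommGroup H] [InnerProductSpace ℂ H] {n : ℕ}
    (T : Matrix (Fin n) (Fin n) (H →L[ℂ] H)) :
    PiLp 2 (fun _ : Fin n => H) →L[ℂ] PiLp 2 (fun _ : Fin n => H) :=
  ((PiLp.continuousLinearEquiv 2 ℂ (fun _ : Fin n => H)).symm :
      (Fin n → H) →L[ℂ] PiLp 2 (fun _ : Fin n => H)) ∘L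
    ContinuousLinearMap.pi
      (fun i => ∑ j, (T i j) ∘L PiLp.proj (𝕜 := ℂ) 2 (fun _ : Fin n => H) j)

theorem blockOp_apply {H : Type*} [NormedAddCommGroup H] [InnerProductSpace ℂ H] {n : ℕ}
    (T : Matrix (Fin n) (Fin n) (H →L[ℂ] H)) (v : PiLp 2 (fun _ : Fin n => H)) (i : Fin n) :
    blockOp T v i = ∑ j, T i j (v j) := by
  simp [blockOp]

/-- The data of a family of matrix norms of a space `V`: `mnorm n A` is the norm of
`A ∈ M_n(V)`. -/
class MatrixNorms (V : Type*) where
  mnorm : ∀ n : ℕ, Matrix (Fin n) (Fin n) V → ℝ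

/-- The matrix norms of `B(H)`: `M_n(B(H))` is identified with `B(H ⊕ ⋯ ⊕ H)`. -/
noncomputable instance instMatrixNormsOperators {H : Type*} [NormedAddCommGroup H]
    [InnerProductSpace ℂ H] : MatrixNorms (H →L[ℂ] H) where
  mnorm _ T := ‖blockOp T‖

/-- A subspace carries the inherited matrix norms. -/
instance instMatrixNormsSubspace {V : Type*} [AddCommGroup V] [Module ℂ V] [MatrixNorms V]
    (W : Submodule ℂ V) : MatrixNorms W where
  mnorm n A := MatrixNorms.mnorm n (A.map (fun w : W => (w : V)))

/-- The quotient matrix norms: `M_n(V ⧸ W)` is identified with `M_n(V) ⧸ M_n(W)`, so the norm of a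
matrix is the infimum of the norms of its lifts to `M_n(V)`. -/
noncomputable instance instMatrixNormsQuotient {V : Type*} [AddCommGroup V] [Module ℂ V]
    [MatrixNorms V] (W : Submodule ℂ V) : MatrixNorms (V ⧸ W) where
  mnorm n A := sInf {r : ℝ | ∃ B : Matrix (Fin n) (Fin n) V,
    B.map (fun v : V => W.mkQ v) = A ∧ MatrixNorms.mnorm n B = r}

/-- All the amplifications `[a_ij] ↦ [φ a_ij]` are contractive. -/
def IsCompleteContraction {V W : Type*} [AddCommGroup V] [Module ℂ V] [MatrixNorms V]
    [AddCommGroup W] [Module ℂ W] [MatrixNorms W] (φ : V →ₗ[ℂ] W) : Prop :=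
  ∀ (n : ℕ) (A : Matrix (Fin n) (Fin n) V),
    MatrixNorms.mnorm n (A.map (fun v => φ v)) ≤ MatrixNorms.mnorm n A

/-- All the amplifications `[a_ij] ↦ [φ a_ij]` are isometric. -/
def IsCompleteIsometry {V W : Type*} [AddCommGroup V] [Module ℂ V] [MatrixNorms V]
    [AddCommGroup W] [Module ℂ W] [MatrixNorms W] (φ : V →ₗ[ℂ] W) : Prop :=
  ∀ (n : ℕ) (A : Matrix (Fin n) (Fin n) V),
    MatrixNorms.mnorm n (A.map (fun v => φ v)) = MatrixNorms.mnorm n A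

/-- Unital completely contractive maps `(V, e) → (W, f)`, where `e` and `f` are the units. -/
def IsUCC {V W : Type*} [AddCommGroup V] [Module ℂ V] [MatrixNorms V]
    [AddCommGroup W] [Module ℂ W] [MatrixNorms W] (e : V) (f : W) (φ : V →ₗ[ℂ] W) : Prop :=
  φ e = f ∧ IsCompleteContraction φ

/-- Unital completely isometric maps `(V, e) → (W, f)`, where `e` and `f` are the units. -/
def IsUCIS {V W : Type*} [AddCommGroup V] [Module ℂ V] [MatrixNorms V]
    [AddCommGroup W] [Module ℂ W] [MatrixNorms W] (e : V) (f : W) (φ : V →ₗ[ℂ] W) : Prop :=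
  φ e = f ∧ IsCompleteIsometry φ

/-- `V`, with its matrix norms and the unit `e`, is a unital operator space: it is, up to a unital
complete isometry, a linear subspace of some `B(K)` that contains the identity operator. -/
def IsUnitalOperatorSpace (V : Type u) [AddCommGroup V] [Module ℂ V] [MatrixNorms V]
    (e : V) : Prop :=
  ∃ (K : Type u) (_ : NormedAddCommGroup K) (_ : InnerProductSpace ℂ K) (_ : CompleteSpace K)
    (j : V →ₗ[ℂ] (K →L[ℂ] K)),
    Function.Injective j ∧ IsUCIS e (1 : K →L[ℂ] K) j

/-- Injectivity of `(E, e)` in the category of unital operator spaces and ucc maps. -/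
def IsInjectiveSpace (E : Type u) [AddCommGroup E] [Module ℂ E] [MatrixNorms E] (e : E) : Prop :=
  ∀ (Y : Type u) [AddCommGroup Y] [Module ℂ Y] [MatrixNorms Y] (y : Y),
    IsUnitalOperatorSpace Y y →
    ∀ (Z : Submodule ℂ Y) (hZ : y ∈ Z) (φ : Z →ₗ[ℂ] E),
      IsUCC (⟨y, hZ⟩ : Z) e φ →
      ∃ ψ : Y →ₗ[ℂ] E, IsUCC y e ψ ∧ ∀ z : Z, ψ (z : Y) = φ z

/-- `(E, ι)` is an extension of the unital operator space `(X, x₀)`; `e` is the unit of `E`. -/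
def IsExtension {X E : Type u} [AddCommGroup X] [Module ℂ X] [MatrixNorms X]
    [AddCommGroup E] [Module ℂ E] [MatrixNorms E] (x₀ : X) (e : E) (ι : X →ₗ[ℂ] E) : Prop :=
  IsUnitalOperatorSpace E e ∧ IsUCIS x₀ e ι

/-- The extension `(E, ι)` is rigid: the identity is the only ucc map `E → E` that fixes the
image of `ι` pointwise. -/
def IsRigid {X E : Type u} [AddCommGroup X] [Module ℂ X]
    [AddCommGroup E] [Module ℂ E] [MatrixNorms E] (e : E) (ι : X →ₗ[ℂ] E) : Prop :=
  ∀ φ : E →ₗ[ℂ] E, IsUCC e e φ → (∀ x : X, φ (ι x) = ι x) → φ = LinearMap.id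

/-- `(E, ι)` is an injective envelope of `(X, x₀)`: an injective extension such that no proper
subspace of `E` that contains the image of `ι` is injective. -/
def IsInjectiveEnvelope {X E : Type u} [AddCommGroup X] [Module ℂ X] [MatrixNorms X]
    [AddCommGroup E] [Module ℂ E] [MatrixNorms E] (x₀ : X) (e : E) (ι : X →ₗ[ℂ] E) : Prop :=
  IsExtension x₀ e ι ∧ IsInjectiveSpace E e ∧
    ∀ (F : Submodule ℂ E) (he : e ∈ F), LinearMap.range ι ≤ F →
      IsInjectiveSpace F (⟨e, he⟩ : F) → F = ⊤

/-- A boundary subsystem for `X` in `B(H)`: a selfadjoint linear subspace `I` such that the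
restriction to `X` of the quotient map `B(H) → B(H) ⧸ I` is completely isometric. -/
def IsBoundarySubsystem {H : Type*} [NormedAddCommGroup H] [InnerProductSpace ℂ H]
    [CompleteSpace H] (X I : Submodule ℂ (H →L[ℂ] H)) : Prop :=
  (∀ a ∈ I, star a ∈ I) ∧ IsCompleteIsometry (I.mkQ ∘ₗ X.subtype)

/-- A boundary subsystem that is maximal with respect to inclusion. -/
def IsMaximalBoundarySubsystem {H : Type*} [NormedAddCommGroup H] [InnerProductSpace ℂ H]
    [CompleteSpace H] (X I : Submodule ℂ (H →L[ℂ] H)) : Prop :=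
  Maximal (IsBoundarySubsystem X) I

/-! Zorn's lemma gives maximal boundary subsystems, because the defining norm inequality only ever
involves the finitely many entries of a matrix. Let `I` be a boundary subsystem, with quotient map
`q`. The map `x + y ↦ x` on `X + I` is completely contractive, so Wittstock's theorem
(`exists_completeContraction_extension`) extends it to a ucc map on `B(H)` that fixes `X` and kills
`I`. If `χ` is any such map, averaging its powers shows that `I + range (χ - id)` is again a
boundary subsystem (`Seminorm.le_add_coboundary`). For maximal `I` this forces `χ a - a ∈ I` for all
`a` (`IsMaximalBoundarySubsystem.map_sub_mem`). Hence `χ` descends to a ucc section `s` of `q`,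
which makes the quotient a ucc retract of `B(H)` and therefore injective. For a ucc map `θ` on the
quotient that fixes `q(X)`, the same fact applied to `s ∘ θ ∘ q` gives `θ = id`. Rigidity and
injectivity together give minimality. Wittstock's theorem itself is a Hahn–Banach argument on `B(K)
⊗ (H ⊗ H*)`, where `tensorGauge` encodes complete contractivity. -/

open scoped InnerProductSpace ComplexConjugate TensorProduct

/-! ### Contractive operator matrices -/

/-- Polarized form of the statement that the operator matrix `A` is a contraction. -/
def ContractiveArray {ι K : Type*} [Fintype ι] [NormedAddCommGroup K] [InnerProductSpace ℂ K]
    (A : ι → ι → K →L[ℂ] K) : Prop :=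
  ∀ v w : ι → K, 2 * (∑ i, ∑ j, ⟪w i, A i j (v j)⟫_ℂ).re ≤ ∑ j, ‖v j‖ ^ 2 + ∑ i, ‖w i‖ ^ 2

section ContractiveArray

variable {K : Type*} [NormedAddCommGroup K] [InnerProductSpace ℂ K]

theorem inner_blockOp {n : ℕ} (T : Matrix (Fin n) (Fin n) (K →L[ℂ] K))
    (v w : PiLp 2 (fun _ : Fin n => K)) :
    ⟪w, blockOp T v⟫_ℂ = ∑ i, ∑ j, ⟪w i, T i j (v j)⟫_ℂ := by
  simp only [PiLp.inner_apply, blockOp_apply, inner_sum]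

/-- One direction is `2ab ≤ a² + b²`; the other tests the inequality at `w = T v`. -/
theorem norm_blockOp_le_one_iff {n : ℕ} (T : Matrix (Fin n) (Fin n) (K →L[ℂ] K)) :
    ‖blockOp T‖ ≤ 1 ↔ ContractiveArray (fun i j => T i j) := by
  constructor
  · intro h v w
    have h1 := inner_blockOp T (WithLp.toLp 2 v) (WithLp.toLp 2 w)
    have h2 := PiLp.norm_sq_eq_of_L2 (fun _ : Fin n => K) (WithLp.toLp 2 v)
    have h3 := PiLp.norm_sq_eq_of_L2 (fun _ : Fin n => K) (WithLp.toLp 2 w)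
    change _ = ∑ i, ∑ j, ⟪w i, T i j (v j)⟫_ℂ at h1
    change _ = ∑ i, ‖v i‖ ^ 2 at h2
    change _ = ∑ i, ‖w i‖ ^ 2 at h3
    rw [← h1, ← h2, ← h3]
    set V : PiLp 2 (fun _ : Fin n => K) := WithLp.toLp 2 v
    set W : PiLp 2 (fun _ : Fin n => K) := WithLp.toLp 2 w
    have h4 : (⟪W, blockOp T V⟫_ℂ).re ≤ ‖W‖ * ‖blockOp T V‖ :=
      (Complex.re_le_norm _).trans (norm_inner_le_norm _ _)
    have h5 : ‖blockOp T V‖ ≤ ‖V‖ := by simpa using (blockOp T).le_of_opNorm_le h V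
    nlinarith [norm_nonneg W, norm_nonneg V, sq_nonneg (‖V‖ - ‖W‖)]
  · intro h
    refine ContinuousLinearMap.opNorm_le_bound _ zero_le_one fun v => ?_
    have h1 := h v (blockOp T v)
    have h2 : (⟪blockOp T v, blockOp T v⟫_ℂ).re = ‖blockOp T v‖ ^ 2 :=
      inner_self_eq_norm_sq (𝕜 := ℂ) _
    rw [← inner_blockOp, ← PiLp.norm_sq_eq_of_L2, ← PiLp.norm_sq_eq_of_L2, h2] at h1
    rw [one_mul]
    nlinarith [norm_nonneg v, norm_nonneg (blockOp T v)]

theorem ContractiveArray.submatrix {ι κ : Type*} [Fintype ι] [Fintype κ] {A : ι → ι → K →L[ℂ] K}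
    (hA : ContractiveArray A) (e : κ ≃ ι) : ContractiveArray (fun i j => A (e i) (e j)) := by
  intro v w
  have := hA (v ∘ e.symm) (w ∘ e.symm)
  rw [← e.sum_comp, ← e.sum_comp, ← e.sum_comp] at this
  simp only [Function.comp, Equiv.symm_apply_apply] at this
  simp_rw [← e.sum_comp (fun j => (⟪_, A _ j _⟫_ℂ))] at this
  simpa using this

theorem ContractiveArray.sumElim {ι κ : Type*} [Fintype ι] [Fintype κ]
    {A : ι → ι → K →L[ℂ] K} {B : κ → κ → K →L[ℂ] K}
    (hA : ContractiveArray A) (hB : ContractiveArray B) :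
    ContractiveArray (Sum.elim (fun i => Sum.elim (A i) 0) (fun i => Sum.elim 0 (B i))) := by
  intro v w
  have h1 := hA (v ∘ Sum.inl) (w ∘ Sum.inl)
  have h2 := hB (v ∘ Sum.inr) (w ∘ Sum.inr)
  simp [Fintype.sum_sum_type] at h1 h2 ⊢
  linarith

theorem sum_norm_sq_unitary {ι : Type*} [Fintype ι] [DecidableEq ι] {u : Matrix ι ι ℂ}
    (hu : u ∈ Matrix.unitaryGroup ι ℂ) (x : ι → K) :
    ∑ i, ‖∑ j, u i j • x j‖ ^ 2 = ∑ j, ‖x j‖ ^ 2 := by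
  have key : ∑ i, ⟪∑ j, u i j • x j, ∑ j, u i j • x j⟫_ℂ = ∑ j, ⟪x j, x j⟫_ℂ := by
    have h1 : ∀ p q, ∑ i, conj (u i p) * u i q = (1 : Matrix ι ι ℂ) p q := by
      intro p q
      rw [← Matrix.mem_unitaryGroup_iff'.1 hu, Matrix.mul_apply]
      simp [Matrix.star_apply]
    calc ∑ i, ⟪∑ j, u i j • x j, ∑ j, u i j • x j⟫_ℂ
        = ∑ i, ∑ p, ∑ q, conj (u i p) * u i q * ⟪x p, x q⟫_ℂ := by
          simp only [sum_inner, inner_smul_left]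
          simp only [inner_sum, inner_smul_right, Finset.mul_sum, mul_assoc]
      _ = ∑ p, ∑ q, (∑ i, conj (u i p) * u i q) * ⟪x p, x q⟫_ℂ := by
          rw [Finset.sum_comm]
          refine Finset.sum_congr rfl fun p _ => ?_
          rw [Finset.sum_comm]
          simp only [Finset.sum_mul]
      _ = ∑ j, ⟪x j, x j⟫_ℂ := by simp [h1, Matrix.one_apply]
  have := congrArg Complex.re key
  simpa [inner_self_eq_norm_sq_to_K, ← Complex.ofReal_pow] using this

theorem ContractiveArray.mul_unitary {ι : Type*} [Fintype ι] [DecidableEq ι]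
    {A : ι → ι → K →L[ℂ] K} (hA : ContractiveArray A) {u : Matrix ι ι ℂ}
    (hu : u ∈ Matrix.unitaryGroup ι ℂ) :
    ContractiveArray (fun i q => ∑ j, u j q • A i j) := by
  intro v w
  have h := hA (fun j => ∑ q, u j q • v q) w
  rw [sum_norm_sq_unitary hu] at h
  have e : ∑ i, ∑ q, ⟪w i, (∑ j, u j q • A i j) (v q)⟫_ℂ =
      ∑ i, ∑ j, ⟪w i, A i j (∑ q, u j q • v q)⟫_ℂ := by
    refine Finset.sum_congr rfl fun i _ => ?_
    simp only [_root_.sum_apply, _root_.smul_apply, map_sum, map_smul, inner_sum]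
    exact Finset.sum_comm
  rwa [e]

theorem ContractiveArray.star_mul_unitary {ι : Type*} [Fintype ι] [DecidableEq ι]
    {A : ι → ι → K →L[ℂ] K} (hA : ContractiveArray A) {u : Matrix ι ι ℂ}
    (hu : u ∈ Matrix.unitaryGroup ι ℂ) :
    ContractiveArray (fun p j => ∑ i, conj (u i p) • A i j) := by
  intro v w
  have h := hA v (fun i => ∑ p, u i p • w p)
  rw [sum_norm_sq_unitary hu] at h
  have e : ∑ p, ∑ j, ⟪w p, (∑ i, conj (u i p) • A i j) (v j)⟫_ℂ =
      ∑ i, ∑ j, ⟪∑ p, u i p • w p, A i j (v j)⟫_ℂ := by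
    simp only [_root_.sum_apply, _root_.smul_apply, inner_sum, sum_inner, inner_smul_left,
      inner_smul_right]
    rw [Finset.sum_comm]
    conv_rhs => rw [Finset.sum_comm]
    refine Finset.sum_congr rfl fun j _ => ?_
    exact Finset.sum_comm
  rwa [e]

/-- Compression by coordinate projections on both sides. It serves to discard the entries paired
with zero vectors. -/
theorem ContractiveArray.ite {ι : Type*} [Fintype ι]
    {A : ι → ι → K →L[ℂ] K} (hA : ContractiveArray A) (P Q : ι → Prop) [DecidablePred P]
    [DecidablePred Q] :
    ContractiveArray (fun i j => if P i ∧ Q j then A i j else 0) := by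
  intro v w
  have h := hA (fun j => if Q j then v j else 0) (fun i => if P i then w i else 0)
  have h1 : ∑ j, ‖if Q j then v j else 0‖ ^ 2 ≤ ∑ j, ‖v j‖ ^ 2 := by
    refine Finset.sum_le_sum fun j _ => ?_
    split_ifs <;> simp
  have h2 : ∑ i, ‖if P i then w i else 0‖ ^ 2 ≤ ∑ i, ‖w i‖ ^ 2 := by
    refine Finset.sum_le_sum fun j _ => ?_
    split_ifs <;> simp
  have h3 : ∑ i, ∑ j, ⟪w i, (if P i ∧ Q j then A i j else 0) (v j)⟫_ℂ =
      ∑ i, ∑ j, ⟪if P i then w i else 0, A i j (if Q j then v j else 0)⟫_ℂ := by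
    refine Finset.sum_congr rfl fun i _ => Finset.sum_congr rfl fun j _ => ?_
    by_cases hP : P i <;> by_cases hQ : Q j <;> simp [hP, hQ]
  rw [h3]
  linarith

/-- Every finite family of vectors is a unitary combination of an orthogonal family. -/
theorem exists_unitary_orthogonal {ι : Type*} [Fintype ι] [DecidableEq ι] (h : ι → K) :
    ∃ (u : Matrix ι ι ℂ) (h' : ι → K), u ∈ Matrix.unitaryGroup ι ℂ ∧
      (∀ j, h j = ∑ p, u j p • h' p) ∧ ∀ p q, p ≠ q → ⟪h' p, h' q⟫_ℂ = 0 := by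
  -- If `U` diagonalizes the Gram matrix `G`, the vectors `∑ j, U j p • h j` have the diagonal Gram
  -- matrix `U* G U`. Unitarity of `U` inverts this with coefficients `conj (U j p)`.
  have hG := Matrix.isHermitian_gram ℂ h
  set U := hG.eigenvectorUnitary with hU
  have hs := hG.spectral_theorem
  have hUU : (U : Matrix ι ι ℂ) * star (U : Matrix ι ι ℂ) = 1 := Matrix.mem_unitaryGroup_iff.1 U.2
  have hUU' : star (U : Matrix ι ι ℂ) * (U : Matrix ι ι ℂ) = 1 := Matrix.mem_unitaryGroup_iff'.1 U.2
  have hd : star (U : Matrix ι ι ℂ) * Matrix.gram ℂ h * (U : Matrix ι ι ℂ)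
      = Matrix.diagonal (RCLike.ofReal ∘ hG.eigenvalues) := by
    conv_lhs => rw [hs]
    rw [Unitary.conjStarAlgAut_apply]
    simp only [← Matrix.mul_assoc]
    rw [hUU', Matrix.one_mul, Matrix.mul_assoc, hUU', Matrix.mul_one]
  refine ⟨(U : Matrix ι ι ℂ).map conj, fun p => ∑ j, (U : Matrix ι ι ℂ) j p • h j, ?_, ?_, ?_⟩
  · rw [Matrix.mem_unitaryGroup_iff]
    ext i j
    have := congrArg conj (congrFun (congrFun hUU i) j)
    simp only [Matrix.mul_apply, map_sum, map_mul, Matrix.star_apply, Matrix.map_apply] at this ⊢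
    rw [Matrix.one_apply] at *
    simpa [apply_ite] using this
  · intro j
    simp only [Finset.smul_sum, smul_smul, Matrix.map_apply]
    rw [Finset.sum_comm]
    have h1 : ∀ k, ∑ p, (conj ((U : Matrix ι ι ℂ) j p) * (U : Matrix ι ι ℂ) k p) • h k
        = (1 : Matrix ι ι ℂ) k j • h k := by
      intro k
      rw [← Finset.sum_smul, ← hUU, Matrix.mul_apply]
      simp [Matrix.star_apply, mul_comm]
    simp [h1, Matrix.one_apply]
  · intro p q hpq
    have h1 := congrFun (congrFun hd p) q
    rw [Matrix.diagonal_apply_ne _ hpq] at h1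
    rw [← h1, Matrix.mul_apply]
    simp only [sum_inner, inner_smul_left]
    simp only [Matrix.mul_apply, inner_sum, inner_smul_right, Matrix.star_apply,
      Matrix.gram_apply, Finset.sum_mul, Finset.mul_sum]
    rw [Finset.sum_comm]
    refine Finset.sum_congr rfl fun i _ => Finset.sum_congr rfl fun j _ => ?_
    simp only [RCLike.star_def]
    ring

end ContractiveArray

/-! ### Hahn–Banach with a sublinear bound on the real part -/

/-- Hahn–Banach for a complex functional whose real part is dominated by a sublinear function. -/
theorem exists_complex_extension_of_re_le {V W : Type*} [AddCommGroup V] [Module ℂ V]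
    [AddCommGroup W] [Module ℂ W] (J : V →ₗ[ℂ] W) (f : V →ₗ[ℂ] ℂ) (N : W → ℝ)
    (N_hom : ∀ c : ℝ, 0 < c → ∀ x, N ((c : ℂ) • x) = c * N x)
    (N_add : ∀ x y, N (x + y) ≤ N x + N y) (hf : ∀ v, (f v).re ≤ N (J v)) :
    ∃ F : W →ₗ[ℂ] ℂ, (∀ v, F (J v) = f v) ∧ ∀ w, (F w).re ≤ N w := by
  have N_0 : N 0 = 0 := by
    have := N_hom 2 (by norm_num) 0
    rw [smul_zero] at this
    linarith
  let fr : V →ₗ[ℝ] ℝ := Complex.reLm.comp (f.restrictScalars ℝ)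
  let Jr : V →ₗ[ℝ] W := J.restrictScalars ℝ
  -- The bound at `v` and `-v` makes `Re f` vanish on the kernel of `J`, so it descends to the
  -- range; `J` need not be injective.
  have hker : LinearMap.ker Jr ≤ LinearMap.ker fr := by
    intro v hv
    have hv' : J v = 0 := hv
    have h1 := hf v
    have h2 := hf (-v)
    rw [map_neg, map_neg, hv', neg_zero, N_0, Complex.neg_re] at h2
    rw [hv', N_0] at h1
    exact le_antisymm h1 (neg_nonpos.1 h2)
  let g0 : LinearMap.range Jr →ₗ[ℝ] ℝ :=
    ((LinearMap.ker Jr).liftQ fr hker).comp Jr.quotKerEquivRange.symm.toLinearMap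
  have hg0 : ∀ v, g0 ⟨Jr v, v, rfl⟩ = fr v := by
    intro v
    have : Jr.quotKerEquivRange.symm ⟨Jr v, v, rfl⟩ = (LinearMap.ker Jr).mkQ v :=
      LinearMap.quotKerEquivRange_symm_apply_image Jr v _
    simp [g0, this]
  obtain ⟨g, hg, hgN⟩ := exists_extension_of_le_sublinear ⟨LinearMap.range Jr, g0⟩ N
    (fun c hc x => by simpa using N_hom c hc x) N_add (by
      rintro ⟨_, v, rfl⟩
      exact (hg0 v).le.trans (hf v))
  have hgJ : ∀ v, g (J v) = (f v).re := fun v => (hg ⟨Jr v, v, rfl⟩).trans (hg0 v)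
  refine ⟨Module.Dual.extendRCLike g, fun v => ?_, fun w => ?_⟩
  · have h1 := Module.Dual.re_extendRCLike_apply (𝕜 := ℂ) g (J v)
    have h2 := Module.Dual.im_extendRCLike_apply (𝕜 := ℂ) g (J v)
    have h3 : g ((RCLike.I : ℂ) • J v) = -(f v).im := by
      rw [← map_smul, hgJ, map_smul]
      simp
    rw [h3, neg_neg] at h2
    rw [hgJ] at h1
    apply Complex.ext
    · exact h1
    · exact h2
  · exact (Module.Dual.re_extendRCLike_apply (𝕜 := ℂ) g w).le.trans (hgN w)

/-! ### Tensors built from operator matrices and vectors -/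

section Representation

variable {H : Type*} [NormedAddCommGroup H] [InnerProductSpace ℂ H]
variable {V W : Type*} [AddCommGroup V] [Module ℂ V] [AddCommGroup W] [Module ℂ W]

/-- The tensor `∑ A i j ⊗ h j ⊗ ⟪k i, ·⟫` in `V ⊗ (H ⊗ H*)`. -/
noncomputable def arrayTensor {ι : Type*} [Fintype ι] (A : ι → ι → V) (h k : ι → H) :
    V ⊗[ℂ] (H ⊗[ℂ] StrongDual ℂ H) :=
  ∑ i, ∑ j, A i j ⊗ₜ[ℂ] (h j ⊗ₜ[ℂ] innerSL ℂ (k i))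

theorem rTensor_arrayTensor {ι : Type*} [Fintype ι] (J : V →ₗ[ℂ] W) (A : ι → ι → V) (h k : ι → H) :
    J.rTensor _ (arrayTensor A h k) = arrayTensor (fun i j => J (A i j)) h k := by
  simp [arrayTensor]

theorem arrayTensor_sumElim {ι κ : Type*} [Fintype ι] [Fintype κ] (A : ι → ι → V) (h k : ι → H)
    (B : κ → κ → V) (h' k' : κ → H) :
    arrayTensor (Sum.elim (fun i => Sum.elim (A i) 0) (fun i => Sum.elim 0 (B i)))
      (Sum.elim h h') (Sum.elim k k') = arrayTensor A h k + arrayTensor B h' k' := by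
  simp [arrayTensor, Fintype.sum_sum_type]

theorem arrayTensor_smul {ι : Type*} [Fintype ι] (A : ι → ι → V) (h k : ι → H) (c d : ℂ) :
    arrayTensor A (fun j => c • h j) (fun i => d • k i) = (c * conj d) • arrayTensor A h k := by
  simp [arrayTensor, Finset.smul_sum, ← TensorProduct.smul_tmul', TensorProduct.tmul_smul,
    smul_smul, mul_comm]

theorem arrayTensor_mul {ι : Type*} [Fintype ι] (A : ι → ι → V) (u : Matrix ι ι ℂ) (h k : ι → H) :
    arrayTensor A (fun j => ∑ q, u j q • h q) k =
      arrayTensor (fun i q => ∑ j, u j q • A i j) h k := by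
  simp only [arrayTensor, TensorProduct.sum_tmul, TensorProduct.tmul_sum]
  refine Finset.sum_congr rfl fun i _ => ?_
  rw [Finset.sum_comm]
  simp only [← TensorProduct.smul_tmul', TensorProduct.tmul_smul]

theorem arrayTensor_star_mul {ι : Type*} [Fintype ι] (A : ι → ι → V) (u : Matrix ι ι ℂ)
    (h k : ι → H) :
    arrayTensor A h (fun i => ∑ p, u i p • k p) =
      arrayTensor (fun p j => ∑ i, conj (u i p) • A i j) h k := by
  simp only [arrayTensor, TensorProduct.sum_tmul, TensorProduct.tmul_sum, map_sum,
    ContinuousLinearMap.map_smulₛₗ]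
  rw [Finset.sum_comm]
  conv_rhs => rw [Finset.sum_comm]
  refine Finset.sum_congr rfl fun j _ => ?_
  rw [Finset.sum_comm]
  simp only [← TensorProduct.smul_tmul', TensorProduct.tmul_smul]

/-- The linear map `V ⊗ (H ⊗ H*) → V`, `a ⊗ h ⊗ f ↦ (⟪x, h⟫ * f y) • a`. -/
noncomputable def tensorSlice (V : Type*) [AddCommGroup V] [Module ℂ V] (x y : H) :
    V ⊗[ℂ] (H ⊗[ℂ] StrongDual ℂ H) →ₗ[ℂ] V :=
  (TensorProduct.rid ℂ V).toLinearMap ∘ₗ LinearMap.lTensor V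
    ((TensorProduct.rid ℂ ℂ).toLinearMap ∘ₗ TensorProduct.map (innerSL ℂ x).toLinearMap
      (ContinuousLinearMap.apply ℂ ℂ y).toLinearMap)

theorem tensorSlice_tmul (x y h : H) (a : V) (f : StrongDual ℂ H) :
    tensorSlice V x y (a ⊗ₜ (h ⊗ₜ f)) = (⟪x, h⟫_ℂ * f y) • a := by
  simp [tensorSlice, mul_comm]

theorem tensorSlice_rTensor (J : V →ₗ[ℂ] W) (x y : H) (w : V ⊗[ℂ] (H ⊗[ℂ] StrongDual ℂ H)) :
    tensorSlice W x y (J.rTensor _ w) = J (tensorSlice V x y w) := by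
  have : tensorSlice W x y ∘ₗ J.rTensor _ = J ∘ₗ tensorSlice V x y := by
    ext a h f
    simp [tensorSlice_tmul]
  exact LinearMap.congr_fun this w

/-- Orthogonality kills every term except `(p, q)`, so an entry attached to nonzero vectors can be
read off from the tensor. -/
theorem tensorSlice_arrayTensor {ι : Type*} [Fintype ι] (A : ι → ι → V) (h k : ι → H)
    (hh : ∀ p q, p ≠ q → ⟪h p, h q⟫_ℂ = 0) (hk : ∀ p q, p ≠ q → ⟪k p, k q⟫_ℂ = 0) (p q : ι) :
    tensorSlice V (h q) (k p) (arrayTensor A h k) =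
      (⟪h q, h q⟫_ℂ * ⟪k p, k p⟫_ℂ) • A p q := by
  classical
  simp only [arrayTensor, map_sum, tensorSlice_tmul, innerSL_apply_apply]
  rw [Finset.sum_eq_single p, Finset.sum_eq_single q]
  · intro j _ hj
    rw [hh q j hj.symm, zero_mul, zero_smul]
  · simp
  · intro i _ hi
    simp [hk i p hi]
  · simp

/-- The functional `a ⊗ h ⊗ f ↦ f (φ a h)`. -/
noncomputable def tensorPairing (φ : V →ₗ[ℂ] H →L[ℂ] H) :
    V ⊗[ℂ] (H ⊗[ℂ] StrongDual ℂ H) →ₗ[ℂ] ℂ :=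
  TensorProduct.lift
    { toFun := fun a => TensorProduct.lift (LinearMap.mk₂ ℂ
        (fun h (f : StrongDual ℂ H) => f (φ a h))
        (by simp) (by simp) (by simp) (by simp))
      map_add' := by intros; ext; simp
      map_smul' := by intros; ext; simp }

theorem tensorPairing_arrayTensor (φ : V →ₗ[ℂ] H →L[ℂ] H) {ι : Type*} [Fintype ι]
    (A : ι → ι → V) (h k : ι → H) :
    tensorPairing φ (arrayTensor A h k) = ∑ i, ∑ j, ⟪k i, φ (A i j) (h j)⟫_ℂ := by
  simp [tensorPairing, arrayTensor]

variable {K : Type*} [NormedAddCommGroup K] [InnerProductSpace ℂ K]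

/-- The entries of `A` need not lie in the range of `j`, so `hφ` does not apply to `A` directly.
Making both families of vectors orthogonal by unitaries keeps the array contractive and the size
unchanged; the entries that matter are then slices of `w`, hence in the range, and the others can be
replaced by zero. -/
theorem re_tensorPairing_le {j : V →ₗ[ℂ] K →L[ℂ] K} (hj : Function.Injective j)
    {φ : V →ₗ[ℂ] H →L[ℂ] H}
    (hφ : ∀ (ι : Type) [Fintype ι] (A : ι → ι → V),
      ContractiveArray (fun p q => j (A p q)) → ContractiveArray (fun p q => φ (A p q)))
    (w : V ⊗[ℂ] (H ⊗[ℂ] StrongDual ℂ H)) {ι : Type} [Fintype ι] {A : ι → ι → K →L[ℂ] K}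
    {h k : ι → H} (hA : ContractiveArray A) (hw : j.rTensor _ w = arrayTensor A h k) :
    2 * (tensorPairing φ w).re ≤ ∑ i, ‖h i‖ ^ 2 + ∑ i, ‖k i‖ ^ 2 := by
  classical
  obtain ⟨u, h', hu, huh, hh'⟩ := exists_unitary_orthogonal h
  obtain ⟨v, k', hv, hvk, hk'⟩ := exists_unitary_orthogonal k
  have eh : ∑ i, ‖h i‖ ^ 2 = ∑ i, ‖h' i‖ ^ 2 := by
    rw [← sum_norm_sq_unitary hu h']; simp only [huh]
  have ek : ∑ i, ‖k i‖ ^ 2 = ∑ i, ‖k' i‖ ^ 2 := by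
    rw [← sum_norm_sq_unitary hv k']; simp only [hvk]
  rw [eh, ek]
  obtain ⟨B, hB, hwB⟩ : ∃ B : ι → ι → K →L[ℂ] K, ContractiveArray B ∧
      j.rTensor _ w = arrayTensor B h' k' := by
    refine ⟨_, (hA.mul_unitary hu).star_mul_unitary hv, ?_⟩
    rw [hw, ← arrayTensor_star_mul, ← arrayTensor_mul, ← funext huh, ← funext hvk]
  have hex : ∀ p q, ∃ c : V, j c = if k' p ≠ 0 ∧ h' q ≠ 0 then B p q else 0 := by
    intro p q
    split_ifs with hpq
    · have h1 := tensorSlice_arrayTensor B h' k' hh' hk' p q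
      rw [← hwB, tensorSlice_rTensor] at h1
      refine ⟨(⟪h' q, h' q⟫_ℂ * ⟪k' p, k' p⟫_ℂ)⁻¹ • tensorSlice V (h' q) (k' p) w, ?_⟩
      rw [map_smul, h1, smul_smul, inv_mul_cancel₀, one_smul]
      exact mul_ne_zero (inner_self_ne_zero.2 hpq.2) (inner_self_ne_zero.2 hpq.1)
    · exact ⟨0, map_zero _⟩
  choose C hC using hex
  have hwC : w = arrayTensor C h' k' := by
    -- Flatness over the field keeps `j ⊗ id` injective, so the two tensors may be compared after
    -- applying it.
    apply Module.Flat.rTensor_preserves_injective_linearMap (M := H ⊗[ℂ] StrongDual ℂ H) j hj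
    rw [rTensor_arrayTensor, hwB]
    refine Finset.sum_congr rfl fun p _ => Finset.sum_congr rfl fun q _ => ?_
    change _ = j (C p q) ⊗ₜ[ℂ] _
    rw [hC]
    split_ifs with hpq
    · rfl
    · rw [not_and_or, not_not, not_not] at hpq
      rcases hpq with hpq | hpq <;> simp [hpq]
  rw [hwC, tensorPairing_arrayTensor]
  refine hφ ι C ?_ h' k'
  simp only [hC]
  exact hB.ite _ _

end Representation

/-- A bounded family of sesquilinear forms, linear in the parameter, is given by a linear map into
the bounded operators. -/
theorem exists_linearMap_of_sesquilinear {H V : Type*} [NormedAddCommGroup H]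
    [InnerProductSpace ℂ H] [CompleteSpace H] [AddCommGroup V] [Module ℂ V]
    (F : V ⊗[ℂ] (H ⊗[ℂ] StrongDual ℂ H) →ₗ[ℂ] ℂ)
    (hF : ∀ a, ∃ C : ℝ, ∀ h k : H, ‖F (a ⊗ₜ (h ⊗ₜ innerSL ℂ k))‖ ≤ C * ‖k‖ * ‖h‖) :
    ∃ ψ : V →ₗ[ℂ] H →L[ℂ] H, ∀ a h k, ⟪k, ψ a h⟫_ℂ = F (a ⊗ₜ (h ⊗ₜ innerSL ℂ k)) := by
  have hex : ∀ a, ∃ T : H →L[ℂ] H, ∀ h k, ⟪k, T h⟫_ℂ = F (a ⊗ₜ (h ⊗ₜ innerSL ℂ k)) := by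
    intro a
    obtain ⟨C, hC⟩ := hF a
    let B : H →L⋆[ℂ] H →L[ℂ] ℂ := LinearMap.mkContinuous₂
      (LinearMap.mk₂'ₛₗ (starRingEnd ℂ) (RingHom.id ℂ)
        (fun k h : H => F (a ⊗ₜ (h ⊗ₜ innerSL ℂ k)))
        (by intros; simp [TensorProduct.tmul_add]) (by intros; simp [TensorProduct.tmul_smul])
        (by intros; simp [TensorProduct.tmul_add, TensorProduct.add_tmul])
        (by intros; simp [TensorProduct.tmul_smul, ← TensorProduct.smul_tmul'])) C
      (fun k h => hC h k)
    refine ⟨(InnerProductSpace.continuousLinearMapOfBilin B).adjoint, fun h k => ?_⟩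
    rw [ContinuousLinearMap.adjoint_inner_right, InnerProductSpace.continuousLinearMapOfBilin_apply]
    rfl
  choose T hT using hex
  refine ⟨{ toFun := T, map_add' := ?_, map_smul' := ?_ }, hT⟩
  · intro a b
    ext h
    refine ext_inner_left ℂ fun k => ?_
    simp [hT, inner_add_right, TensorProduct.add_tmul]
  · intro c a
    ext h
    refine ext_inner_left ℂ fun k => ?_
    simp [hT, inner_smul_right, ← TensorProduct.smul_tmul']

/-! ### Matrix norms in terms of contractive arrays -/

section Scaling

variable {K : Type*} [NormedAddCommGroup K] [InnerProductSpace ℂ K]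

theorem contractiveArray_unit {a : K →L[ℂ] K} (ha : ‖a‖ ≤ 1) :
    ContractiveArray (fun _ _ : Unit => a) := by
  intro v w
  have h1 : (⟪w (), a (v ())⟫_ℂ).re ≤ ‖w ()‖ * ‖a (v ())‖ :=
    (Complex.re_le_norm _).trans (norm_inner_le_norm _ _)
  have h2 : ‖a (v ())‖ ≤ ‖v ()‖ := by simpa using a.le_of_opNorm_le ha (v ())
  simp only [Finset.univ_unique, Finset.sum_singleton, PUnit.default_eq_unit]
  nlinarith [norm_nonneg (w ()), norm_nonneg (v ()), sq_nonneg (‖v ()‖ - ‖w ()‖)]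

theorem norm_blockOp_smul_le {n : ℕ} (c : ℂ) (T : Matrix (Fin n) (Fin n) (K →L[ℂ] K)) :
    ‖blockOp (c • T)‖ ≤ ‖c‖ * ‖blockOp T‖ := by
  refine ContinuousLinearMap.opNorm_le_bound _
    (mul_nonneg (norm_nonneg _) (ContinuousLinearMap.opNorm_nonneg _)) fun v => ?_
  have h : blockOp (c • T) v = c • blockOp T v := by
    ext i
    simp [blockOp_apply, Finset.smul_sum]
  rw [h, norm_smul, mul_assoc]
  exact mul_le_mul_of_nonneg_left ((blockOp T).le_opNorm v) (norm_nonneg c)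

theorem norm_blockOp_smul (c : ℂ) {n : ℕ} (T : Matrix (Fin n) (Fin n) (K →L[ℂ] K)) :
    ‖blockOp (c • T)‖ = ‖c‖ * ‖blockOp T‖ := by
  refine le_antisymm (norm_blockOp_smul_le c T) ?_
  rcases eq_or_ne c 0 with rfl | hc
  · rw [norm_zero, zero_mul]
    exact ContinuousLinearMap.opNorm_nonneg _
  · have h := norm_blockOp_smul_le c⁻¹ (c • T)
    rw [smul_smul, inv_mul_cancel₀ hc, one_smul, norm_inv,
      ← div_eq_inv_mul, le_div_iff₀' (norm_pos_iff.2 hc)] at h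
    exact h

theorem norm_blockOp_add_le {n : ℕ} (S T : Matrix (Fin n) (Fin n) (K →L[ℂ] K)) :
    ‖blockOp (S + T)‖ ≤ ‖blockOp S‖ + ‖blockOp T‖ := by
  refine ContinuousLinearMap.opNorm_le_bound _ (add_nonneg
    (ContinuousLinearMap.opNorm_nonneg _) (ContinuousLinearMap.opNorm_nonneg _)) fun v => ?_
  have h : blockOp (S + T) v = blockOp S v + blockOp T v := by
    ext i
    simp [blockOp_apply, Finset.sum_add_distrib]
  rw [h, add_mul]
  exact (norm_add_le _ _).trans (add_le_add ((blockOp S).le_opNorm v) ((blockOp T).le_opNorm v))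

/-- Comparing unit balls suffices by homogeneity; dividing by `‖blockOp S‖ + ε` covers the case of
norm zero. -/
theorem norm_blockOp_le_of_contractiveArray {L : Type*} [NormedAddCommGroup L]
    [InnerProductSpace ℂ L] {n : ℕ} {S : Matrix (Fin n) (Fin n) (L →L[ℂ] L)}
    {T : Matrix (Fin n) (Fin n) (K →L[ℂ] K)}
    (h : ∀ c : ℂ, ContractiveArray (fun i j => c • S i j) →
      ContractiveArray (fun i j => c • T i j)) :
    ‖blockOp T‖ ≤ ‖blockOp S‖ := by
  refine le_of_forall_pos_le_add fun ε hε => ?_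
  have hr : 0 < ‖blockOp S‖ + ε :=
    add_pos_of_nonneg_of_pos (ContinuousLinearMap.opNorm_nonneg _) hε
  have h1 : ‖blockOp ((((‖blockOp S‖ + ε)⁻¹ : ℝ) : ℂ) • S)‖ ≤ 1 := by
    rw [norm_blockOp_smul, Complex.norm_real, Real.norm_of_nonneg (inv_pos.2 hr).le,
      inv_mul_le_iff₀ hr]
    linarith
  have h2 := (norm_blockOp_le_one_iff ((((‖blockOp S‖ + ε)⁻¹ : ℝ) : ℂ) • T)).2
    (h _ ((norm_blockOp_le_one_iff _).1 h1))
  rw [norm_blockOp_smul, Complex.norm_real, Real.norm_of_nonneg (inv_pos.2 hr).le,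
      inv_mul_le_iff₀ hr] at h2
  linarith

theorem ContractiveArray.of_norm_blockOp_le {V H : Type*} [AddCommGroup V] [Module ℂ V]
    [NormedAddCommGroup H] [InnerProductSpace ℂ H] {j : V →ₗ[ℂ] K →L[ℂ] K} {φ : V →ₗ[ℂ] H →L[ℂ] H}
    (hφ : ∀ (n : ℕ) (A : Matrix (Fin n) (Fin n) V),
      ‖blockOp (A.map (fun v => φ v))‖ ≤ ‖blockOp (A.map (fun v => j v))‖)
    {ι : Type} [Fintype ι] (A : ι → ι → V) (hA : ContractiveArray (fun p q => j (A p q))) :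
    ContractiveArray (fun p q => φ (A p q)) := by
  let e := Fintype.equivFin ι
  have h1 := (norm_blockOp_le_one_iff
    ((Matrix.of fun p q => A (e.symm p) (e.symm q)).map (fun v => j v))).2 (hA.submatrix e.symm)
  have h2 := ((norm_blockOp_le_one_iff _).1 ((hφ _ _).trans h1)).submatrix e
  simpa using h2

end Scaling

/-! ### The tensor gauge and Wittstock's extension theorem -/

section Gauge

variable {K H : Type*} [NormedAddCommGroup K] [InnerProductSpace ℂ K]
  [NormedAddCommGroup H] [InnerProductSpace ℂ H]

/-- `r` is the size of a representation of `u` by a contractive array and two families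
of vectors. -/
def HasTensorSize (u : (K →L[ℂ] K) ⊗[ℂ] (H ⊗[ℂ] StrongDual ℂ H)) (r : ℝ) : Prop :=
  ∃ (ι : Type) (_ : Fintype ι) (A : ι → ι → K →L[ℂ] K) (h k : ι → H),
    ContractiveArray A ∧ u = arrayTensor A h k ∧ r = ∑ i, ‖h i‖ ^ 2 + ∑ i, ‖k i‖ ^ 2

theorem HasTensorSize.nonneg {u : (K →L[ℂ] K) ⊗[ℂ] (H ⊗[ℂ] StrongDual ℂ H)} {r : ℝ}
    (hu : HasTensorSize u r) : 0 ≤ r := by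
  obtain ⟨ι, _, A, h, k, -, -, rfl⟩ := hu
  positivity

theorem HasTensorSize.add {u v : (K →L[ℂ] K) ⊗[ℂ] (H ⊗[ℂ] StrongDual ℂ H)} {r s : ℝ}
    (hu : HasTensorSize u r) (hv : HasTensorSize v s) : HasTensorSize (u + v) (r + s) := by
  obtain ⟨ι, _, A, h, k, hA, rfl, rfl⟩ := hu
  obtain ⟨κ, _, B, h', k', hB, rfl, rfl⟩ := hv
  refine ⟨ι ⊕ κ, inferInstance, _, _, _, hA.sumElim hB,
    (arrayTensor_sumElim A h k B h' k').symm, ?_⟩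
  simp only [Fintype.sum_sum_type, Sum.elim_inl, Sum.elim_inr]
  ring

theorem HasTensorSize.smul {u : (K →L[ℂ] K) ⊗[ℂ] (H ⊗[ℂ] StrongDual ℂ H)} {r : ℝ}
    (hu : HasTensorSize u r) {c : ℝ} (hc : 0 ≤ c) : HasTensorSize ((c : ℂ) • u) (c * r) := by
  obtain ⟨ι, _, A, h, k, hA, rfl, rfl⟩ := hu
  -- The scalar is split as `√c · √c` between the two families, which leaves the array contractive.
  refine ⟨ι, inferInstance, A, fun i => ((√c : ℝ) : ℂ) • h i, fun i => ((√c : ℝ) : ℂ) • k i,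
    hA, ?_, ?_⟩
  · rw [arrayTensor_smul, Complex.conj_ofReal, ← Complex.ofReal_mul, Real.mul_self_sqrt hc]
  · simp only [norm_smul, Complex.norm_real, mul_pow, Real.norm_eq_abs, sq_abs, Real.sq_sqrt hc]
    rw [← Finset.mul_sum, ← Finset.mul_sum, mul_add]

theorem hasTensorSize_tmul {a : K →L[ℂ] K} (ha : ‖a‖ ≤ 1) (h k : H) :
    HasTensorSize (a ⊗ₜ[ℂ] (h ⊗ₜ[ℂ] innerSL ℂ k)) (‖h‖ ^ 2 + ‖k‖ ^ 2) :=
  ⟨Unit, inferInstance, fun _ _ => a, fun _ => h, fun _ => k, contractiveArray_unit ha,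
    by simp [arrayTensor], by simp⟩

theorem exists_smul_norm_le_one (a : K →L[ℂ] K) : ∃ (c : ℝ) (b : K →L[ℂ] K), 0 ≤ c ∧ ‖b‖ ≤ 1 ∧
    a = (c : ℂ) • b := by
  have hr : 0 < ‖a‖ + 1 := by positivity
  refine ⟨‖a‖ + 1, (((‖a‖ + 1)⁻¹ : ℝ) : ℂ) • a, hr.le, ?_, ?_⟩
  · rw [norm_smul, Complex.norm_real, Real.norm_of_nonneg (by positivity), inv_mul_le_iff₀ hr]
    linarith
  · rw [smul_smul, ← Complex.ofReal_mul, mul_inv_cancel₀ hr.ne', Complex.ofReal_one, one_smul]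

/-- The infimum in `tensorGauge` is thus over a nonempty set. Completeness enters through the Riesz
representation of functionals. -/
theorem exists_hasTensorSize [CompleteSpace H]
    (u : (K →L[ℂ] K) ⊗[ℂ] (H ⊗[ℂ] StrongDual ℂ H)) : ∃ r, HasTensorSize u r := by
  induction u with
  | zero => exact ⟨0, Empty, inferInstance, fun _ _ => 0, fun _ => 0, fun _ => 0,
      by intro v w; simp, by simp [arrayTensor], by simp⟩
  | add x y hx hy =>
    obtain ⟨r, hr⟩ := hx
    obtain ⟨s, hs⟩ := hy
    exact ⟨_, hr.add hs⟩
  | tmul a p =>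
    induction p with
    | zero => exact ⟨0, Empty, inferInstance, fun _ _ => 0, fun _ => 0, fun _ => 0,
      by intro v w; simp, by simp [arrayTensor], by simp⟩
    | add x y hx hy =>
      obtain ⟨r, hr⟩ := hx
      obtain ⟨s, hs⟩ := hy
      rw [TensorProduct.tmul_add]
      exact ⟨_, hr.add hs⟩
    | tmul h f =>
      obtain ⟨k, rfl⟩ := (InnerProductSpace.toDual ℂ H).surjective f
      obtain ⟨c, b, hc, hb, rfl⟩ := exists_smul_norm_le_one a
      rw [← TensorProduct.smul_tmul']
      exact ⟨_, (hasTensorSize_tmul hb h k).smul hc⟩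

/-- The gauge that controls completely contractive maps `B(K) → B(H)`. -/
noncomputable def tensorGauge (u : (K →L[ℂ] K) ⊗[ℂ] (H ⊗[ℂ] StrongDual ℂ H)) : ℝ :=
  sInf {r | HasTensorSize u r}

theorem tensorGauge_le {u : (K →L[ℂ] K) ⊗[ℂ] (H ⊗[ℂ] StrongDual ℂ H)} {r : ℝ}
    (hu : HasTensorSize u r) : tensorGauge u ≤ r :=
  csInf_le ⟨0, fun _ h => h.nonneg⟩ hu

variable [CompleteSpace H]

theorem le_tensorGauge {u : (K →L[ℂ] K) ⊗[ℂ] (H ⊗[ℂ] StrongDual ℂ H)} {s : ℝ}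
    (h : ∀ r, HasTensorSize u r → s ≤ r) : s ≤ tensorGauge u :=
  le_csInf (exists_hasTensorSize u) h

theorem tensorGauge_add_le (u v : (K →L[ℂ] K) ⊗[ℂ] (H ⊗[ℂ] StrongDual ℂ H)) :
    tensorGauge (u + v) ≤ tensorGauge u + tensorGauge v := by
  rw [← sub_le_iff_le_add]
  refine le_tensorGauge fun r hr => ?_
  rw [sub_le_comm]
  refine le_tensorGauge fun s hs => ?_
  linarith [tensorGauge_le (hr.add hs)]

theorem tensorGauge_smul {c : ℝ} (hc : 0 < c) (u : (K →L[ℂ] K) ⊗[ℂ] (H ⊗[ℂ] StrongDual ℂ H)) :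
    tensorGauge ((c : ℂ) • u) = c * tensorGauge u := by
  apply le_antisymm
  · rw [← div_le_iff₀' hc]
    refine le_tensorGauge fun r hr => ?_
    rw [div_le_iff₀' hc]
    exact tensorGauge_le (hr.smul hc.le)
  · refine le_tensorGauge fun r hr => ?_
    rw [← le_div_iff₀' hc]
    have h1 := hr.smul (inv_nonneg.2 hc.le)
    rw [smul_smul, ← Complex.ofReal_mul, inv_mul_cancel₀ hc.ne', Complex.ofReal_one, one_smul] at h1
    exact (tensorGauge_le h1).trans (by rw [div_eq_inv_mul])

end Gauge

/-- Wittstock's extension theorem: a map into `B(H)` that is completely contractive for the matrix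
norms induced by an embedding into `B(K)` extends to a complete contraction on `B(K)`. -/
theorem exists_completeContraction_extension {V K H : Type*} [AddCommGroup V] [Module ℂ V]
    [NormedAddCommGroup K] [InnerProductSpace ℂ K]
    [NormedAddCommGroup H] [InnerProductSpace ℂ H] [CompleteSpace H]
    {j : V →ₗ[ℂ] K →L[ℂ] K} (hj : Function.Injective j) {φ : V →ₗ[ℂ] H →L[ℂ] H}
    (hφ : ∀ (n : ℕ) (A : Matrix (Fin n) (Fin n) V),
      ‖blockOp (A.map (fun v => φ v))‖ ≤ ‖blockOp (A.map (fun v => j v))‖) :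
    ∃ ψ : (K →L[ℂ] K) →ₗ[ℂ] H →L[ℂ] H, IsCompleteContraction ψ ∧ ∀ v, ψ (j v) = φ v := by
  -- The factor `2` is the one in `ContractiveArray`; it is undone by `2⁻¹` when `ψ` is defined.
  obtain ⟨F, hFJ, hF⟩ := exists_complex_extension_of_re_le
    (j.rTensor (H ⊗[ℂ] StrongDual ℂ H)) ((2 : ℂ) • tensorPairing φ) tensorGauge
    (fun c hc => tensorGauge_smul hc) tensorGauge_add_le (by
      intro w
      refine le_tensorGauge fun r hr => ?_
      obtain ⟨ι, _, A, h, k, hA, hw, rfl⟩ := hr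
      have := re_tensorPairing_le hj (fun ι _ A => ContractiveArray.of_norm_blockOp_le hφ A) w hA hw
      simpa using this)
  have hbound : ∀ (a : K →L[ℂ] K), ‖a‖ ≤ 1 → ∀ h k : H,
      ‖F (a ⊗ₜ (h ⊗ₜ innerSL ℂ k))‖ ≤ 2 * (‖k‖ * ‖h‖) := by
    intro a ha h k
    set z := F (a ⊗ₜ (h ⊗ₜ innerSL ℂ k)) with hz
    -- The factor `conj z` makes the value of `F` real and nonnegative; `‖k‖` and `‖z‖ * ‖h‖`
    -- balance the two vectors, so the size is `2 (‖k‖ ‖h‖ ‖z‖)²`.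
    have h1 := (hF _).trans (tensorGauge_le (hasTensorSize_tmul ha
      (((‖k‖ : ℂ) * conj z) • h) (((‖z‖ * ‖h‖ : ℝ) : ℂ) • k)))
    have h2 : F (a ⊗ₜ ((((‖k‖ : ℂ) * conj z) • h) ⊗ₜ innerSL ℂ (((‖z‖ * ‖h‖ : ℝ) : ℂ) • k))) =
        ((‖k‖ * (‖z‖ * ‖h‖) * ‖z‖ ^ 2 : ℝ) : ℂ) := by
      rw [map_smulₛₗ, ← TensorProduct.smul_tmul', TensorProduct.tmul_smul, TensorProduct.tmul_smul,
        TensorProduct.tmul_smul, map_smul, map_smul, ← hz, Complex.conj_ofReal, smul_eq_mul,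
        smul_eq_mul]
      push_cast
      rw [← Complex.conj_mul']
      ring
    rw [h2, Complex.ofReal_re] at h1
    simp only [norm_smul, norm_mul, Complex.norm_real, norm_norm, RCLike.norm_conj] at h1
    rcases (norm_nonneg z).eq_or_lt with hz0 | hz0
    · rw [← hz0]; positivity
    rcases (norm_nonneg h).eq_or_lt with hh | hh
    · rw [hz, norm_eq_zero.1 hh.symm]; simp
    rcases (norm_nonneg k).eq_or_lt with hk | hk
    · rw [hz, norm_eq_zero.1 hk.symm]; simp
    have hp : 0 < ‖k‖ * ‖h‖ * ‖z‖ ^ 2 := by positivity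
    refine le_of_mul_le_mul_left ?_ hp
    convert h1 using 1
    · ring
    · ring
  obtain ⟨ψ, hψ⟩ := exists_linearMap_of_sesquilinear ((2⁻¹ : ℂ) • F) (by
    intro a
    obtain ⟨c, b, hc, hb, rfl⟩ := exists_smul_norm_le_one a
    refine ⟨c, fun h k => ?_⟩
    have h1 := hbound b hb h k
    rw [← TensorProduct.smul_tmul', map_smul, LinearMap.smul_apply, norm_smul, norm_smul,
      Complex.norm_real, Real.norm_of_nonneg hc, mul_assoc]
    refine mul_le_mul_of_nonneg_left ?_ hc
    norm_num
    linarith)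
  refine ⟨ψ, fun n A => ?_, fun v => ?_⟩
  -- A contractive array with vectors `v`, `w` is itself a representation of its tensor, so the
  -- gauge bound on `F` is exactly contractivity of the image array.
  · refine norm_blockOp_le_of_contractiveArray fun c hA v w => ?_
    have h1 := (hF _).trans (tensorGauge_le ⟨_, _, _, v, w, hA, rfl, rfl⟩)
    refine le_trans (le_of_eq ?_) h1
    have h2 : ∑ i, ∑ l, ⟪w i, (c • A.map (fun v => ψ v) i l) (v l)⟫_ℂ =
        2⁻¹ * F (arrayTensor (fun i l => c • A i l) v w) := by
      simp only [arrayTensor, map_sum, Finset.mul_sum]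
      refine Finset.sum_congr rfl fun i _ => Finset.sum_congr rfl fun l _ => ?_
      rw [Matrix.map_apply, ← map_smul, hψ]
      rfl
    rw [h2]
    simp
  · ext h
    refine ext_inner_left ℂ fun k => ?_
    have h1 := hFJ (v ⊗ₜ (h ⊗ₜ innerSL ℂ k))
    rw [hψ]
    rw [LinearMap.rTensor_tmul] at h1
    simp [h1, tensorPairing]

/-! ### Unital contractions preserve adjoints -/

section UnitalMaps

variable {H : Type*} [NormedAddCommGroup H] [InnerProductSpace ℂ H]

theorem norm_blockOp_fin_one (a : H →L[ℂ] H) :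
    ‖blockOp (Matrix.of fun _ _ : Fin 1 => a)‖ = ‖a‖ := by
  apply le_antisymm
  · refine ContinuousLinearMap.opNorm_le_bound _ (norm_nonneg a) fun v => ?_
    rw [PiLp.norm_eq_of_L2, PiLp.norm_eq_of_L2]
    simpa [blockOp_apply] using a.le_opNorm (v 0)
  · refine ContinuousLinearMap.opNorm_le_bound _ (ContinuousLinearMap.opNorm_nonneg _) fun x => ?_
    have h := (blockOp (Matrix.of fun _ _ : Fin 1 => a)).le_opNorm (WithLp.toLp 2 fun _ => x)
    rw [PiLp.norm_eq_of_L2, PiLp.norm_eq_of_L2] at h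
    simpa [blockOp_apply] using h

theorem IsCompleteContraction.norm_apply_le {K : Type*} [NormedAddCommGroup K]
    [InnerProductSpace ℂ K] {φ : (K →L[ℂ] K) →ₗ[ℂ] H →L[ℂ] H} (hφ : IsCompleteContraction φ)
    (a : K →L[ℂ] K) : ‖φ a‖ ≤ ‖a‖ := by
  rw [← norm_blockOp_fin_one, ← norm_blockOp_fin_one a]
  exact hφ 1 (Matrix.of fun _ _ => a)

variable [CompleteSpace H]

/-- For selfadjoint `a`, `‖a + it‖² ≤ ‖a‖² + t²`. A nonzero imaginary part of `⟪φ a x, x⟫` would add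
a term linear in `t` that this bound does not allow. -/
theorem isSelfAdjoint_map_of_unital_contraction {φ : (H →L[ℂ] H) →ₗ[ℂ] H →L[ℂ] H} (h1 : φ 1 = 1)
    (hφ : ∀ a, ‖φ a‖ ≤ ‖a‖) {a : H →L[ℂ] H} (ha : IsSelfAdjoint a) : IsSelfAdjoint (φ a) := by
  rw [ContinuousLinearMap.isSelfAdjoint_iff_isSymmetric,
    LinearMap.isSymmetric_iff_inner_map_self_real]
  have hsymm := (ContinuousLinearMap.isSelfAdjoint_iff_isSymmetric.1 ha)
  have hnorm : ∀ t : ℝ, ‖a + ((t : ℂ) * Complex.I) • (1 : H →L[ℂ] H)‖ ^ 2 ≤ ‖a‖ ^ 2 + t ^ 2 := by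
    intro t
    have : ‖a + ((t : ℂ) * Complex.I) • (1 : H →L[ℂ] H)‖ ≤ √(‖a‖ ^ 2 + t ^ 2) := by
      refine ContinuousLinearMap.opNorm_le_bound _ (Real.sqrt_nonneg _) fun x => ?_
      refine abs_le_of_sq_le_sq' ?_ (by positivity) |>.2
      have him : (⟪a x, x⟫_ℂ).im = 0 := by
        have h := hsymm.im_inner_apply_self x
        exact h
      have e : ‖(a + ((t : ℂ) * Complex.I) • (1 : H →L[ℂ] H)) x‖ ^ 2
          = ‖a x‖ ^ 2 + t ^ 2 * ‖x‖ ^ 2 := by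
        have h := norm_add_sq (𝕜 := ℂ) (a x) (((t : ℂ) * Complex.I) • x)
        have h2 : RCLike.re ⟪a x, ((t : ℂ) * Complex.I) • x⟫_ℂ = 0 := by
          rw [inner_smul_right]
          simp [him]
        rw [h2] at h
        simpa [norm_smul, mul_pow] using h
      rw [e, mul_pow, Real.sq_sqrt (by positivity), add_mul]
      have := pow_le_pow_left₀ (norm_nonneg _) (a.le_opNorm x) 2
      rw [mul_pow] at this
      linarith
    calc _ ≤ √(‖a‖ ^ 2 + t ^ 2) ^ 2 := pow_le_pow_left₀ (norm_nonneg _) this 2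
      _ = _ := Real.sq_sqrt (by positivity)
  intro x
  rw [Complex.conj_eq_iff_im]
  change (⟪φ a x, x⟫_ℂ).im = 0
  set δ := (⟪φ a x, x⟫_ℂ).im with hδ
  have hbound : ∀ t : ℝ, (δ - t * ‖x‖ ^ 2) ^ 2 ≤ (‖a‖ ^ 2 + t ^ 2) * (‖x‖ ^ 2) ^ 2 := by
    intro t
    have h2 : φ (a + ((t : ℂ) * Complex.I) • 1) = φ a + ((t : ℂ) * Complex.I) • 1 := by
      rw [map_add, map_smul, h1]
    have h3 : (⟪φ (a + ((t : ℂ) * Complex.I) • 1) x, x⟫_ℂ).im = δ - t * ‖x‖ ^ 2 := by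
      rw [h2, _root_.add_apply, inner_add_left, Complex.add_im, ← hδ, _root_.smul_apply,
        inner_smul_left, one_apply_eq_self, inner_self_eq_norm_sq_to_K]
      simp [← Complex.ofReal_pow]
      ring
    have h4 : |δ - t * ‖x‖ ^ 2| ≤ ‖a + ((t : ℂ) * Complex.I) • (1 : H →L[ℂ] H)‖ * ‖x‖ ^ 2 := by
      rw [← h3]
      refine (Complex.abs_im_le_norm _).trans ((norm_inner_le_norm _ _).trans ?_)
      rw [sq, ← mul_assoc]
      exact mul_le_mul_of_nonneg_right (ContinuousLinearMap.le_of_opNorm_le _ (hφ _) x)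
        (norm_nonneg x)
    calc _ = |δ - t * ‖x‖ ^ 2| ^ 2 := (sq_abs _).symm
      _ ≤ (‖a + ((t : ℂ) * Complex.I) • (1 : H →L[ℂ] H)‖ * ‖x‖ ^ 2) ^ 2 :=
        pow_le_pow_left₀ (abs_nonneg _) h4 2
      _ ≤ _ := by
        rw [mul_pow]
        exact mul_le_mul_of_nonneg_right (hnorm t) (by positivity)
  by_contra hne
  have hx : 0 < ‖x‖ ^ 2 := by
    rcases eq_or_ne x 0 with rfl | hx
    · simp [hδ] at hne
    · positivity
  -- This `t` makes the linear term `-2 t δ ‖x‖²` equal to `‖a‖² ‖x‖⁴`, which leaves `δ² ≤ 0`.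
  have h5 := hbound (-(‖a‖ ^ 2 * (‖x‖ ^ 2) ^ 2 / (2 * δ * ‖x‖ ^ 2)))
  have h6 : -(‖a‖ ^ 2 * (‖x‖ ^ 2) ^ 2 / (2 * δ * ‖x‖ ^ 2)) * (2 * δ * ‖x‖ ^ 2)
      = -(‖a‖ ^ 2 * (‖x‖ ^ 2) ^ 2) := by
    field_simp
  have h7 : 0 < δ ^ 2 := by positivity
  nlinarith

theorem map_star_of_unital_contraction {φ : (H →L[ℂ] H) →ₗ[ℂ] H →L[ℂ] H} (h1 : φ 1 = 1)
    (hφ : ∀ a, ‖φ a‖ ≤ ‖a‖) (a : H →L[ℂ] H) : φ (star a) = star (φ a) := by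
  have hr := (isSelfAdjoint_map_of_unital_contraction h1 hφ (realPart a).2).star_eq
  have hi := (isSelfAdjoint_map_of_unital_contraction h1 hφ (imaginaryPart a).2).star_eq
  have e := realPart_add_I_smul_imaginaryPart a
  have hs : star a = (realPart a : H →L[ℂ] H) - Complex.I • (imaginaryPart a : H →L[ℂ] H) := by
    conv_lhs => rw [← e]
    rw [star_add, star_smul, (realPart a).2.star_eq, (imaginaryPart a).2.star_eq]
    simp [sub_eq_add_neg]
  rw [hs, map_sub, map_smul]
  conv_rhs => rw [← e, map_add, map_smul, star_add, star_smul, hr, hi]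
  simp [sub_eq_add_neg]

end UnitalMaps

/-! ### Quotient matrix norms -/

section Quotient

variable {H : Type*} [NormedAddCommGroup H] [InnerProductSpace ℂ H]

theorem bddBelow_lift_norms (I : Submodule ℂ (H →L[ℂ] H)) {n : ℕ}
    (A : Matrix (Fin n) (Fin n) ((H →L[ℂ] H) ⧸ I)) :
    BddBelow {r : ℝ | ∃ B : Matrix (Fin n) (Fin n) (H →L[ℂ] H),
      B.map (fun v => I.mkQ v) = A ∧ MatrixNorms.mnorm n B = r} := by
  refine ⟨0, ?_⟩
  rintro _ ⟨B, -, rfl⟩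
  exact ContinuousLinearMap.opNorm_nonneg _

theorem exists_matrix_lift (I : Submodule ℂ (H →L[ℂ] H)) {n : ℕ}
    (A : Matrix (Fin n) (Fin n) ((H →L[ℂ] H) ⧸ I)) :
    ∃ B : Matrix (Fin n) (Fin n) (H →L[ℂ] H), B.map (fun v => I.mkQ v) = A := by
  choose f hf using fun i j => I.mkQ_surjective (A i j)
  exact ⟨f, by ext i j; exact hf i j⟩

theorem isCompleteContraction_mkQ (I : Submodule ℂ (H →L[ℂ] H)) :
    IsCompleteContraction I.mkQ :=
  fun _ B => csInf_le (bddBelow_lift_norms I _) ⟨B, rfl, rfl⟩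

theorem le_mnorm_quotient {I : Submodule ℂ (H →L[ℂ] H)} {n : ℕ}
    {A : Matrix (Fin n) (Fin n) ((H →L[ℂ] H) ⧸ I)} {s : ℝ}
    (h : ∀ B : Matrix (Fin n) (Fin n) (H →L[ℂ] H), B.map (fun v => I.mkQ v) = A →
      s ≤ MatrixNorms.mnorm n B) : s ≤ MatrixNorms.mnorm n A := by
  obtain ⟨B, hB⟩ := exists_matrix_lift I A
  refine le_csInf ⟨_, B, hB, rfl⟩ ?_
  rintro _ ⟨C, hC, rfl⟩
  exact h C hC

theorem isCompleteContraction_of_comp_mkQ {W : Type*} [AddCommGroup W] [Module ℂ W] [MatrixNorms W]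
    {I : Submodule ℂ (H →L[ℂ] H)} {φ : ((H →L[ℂ] H) ⧸ I) →ₗ[ℂ] W}
    (h : IsCompleteContraction (φ ∘ₗ I.mkQ)) : IsCompleteContraction φ := by
  intro n A
  refine le_mnorm_quotient ?_
  rintro B rfl
  exact h n B

theorem IsCompleteContraction.comp {U V W : Type*} [AddCommGroup U] [Module ℂ U] [MatrixNorms U]
    [AddCommGroup V] [Module ℂ V] [MatrixNorms V] [AddCommGroup W] [Module ℂ W] [MatrixNorms W]
    {ψ : V →ₗ[ℂ] W} {φ : U →ₗ[ℂ] V} (hψ : IsCompleteContraction ψ) (hφ : IsCompleteContraction φ) :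
    IsCompleteContraction (ψ ∘ₗ φ) :=
  fun n A => (hψ n (A.map fun v => φ v)).trans (hφ n A)

theorem IsCompleteIsometry.isCompleteContraction {V W : Type*} [AddCommGroup V] [Module ℂ V]
    [MatrixNorms V] [AddCommGroup W] [Module ℂ W] [MatrixNorms W] {φ : V →ₗ[ℂ] W}
    (h : IsCompleteIsometry φ) : IsCompleteContraction φ :=
  fun n A => (h n A).le

/-- The quotient map is always completely contractive, so only the lower bound has content. This
form avoids the infimum and concerns finitely many elements at a time. -/
theorem isCompleteIsometry_mkQ_comp_subtype_iff {X I : Submodule ℂ (H →L[ℂ] H)} :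
    IsCompleteIsometry (I.mkQ ∘ₗ X.subtype) ↔
      ∀ (n : ℕ) (A B : Matrix (Fin n) (Fin n) (H →L[ℂ] H)), (∀ i j, A i j ∈ X) →
        (∀ i j, B i j ∈ I) → ‖blockOp A‖ ≤ ‖blockOp (A + B)‖ := by
  constructor
  · intro h n A B hA hB
    have h1 := h n (Matrix.of fun i j => ⟨A i j, hA i j⟩)
    have h2 := isCompleteContraction_mkQ I n (A + B)
    refine (le_of_eq h1.symm).trans (le_trans (le_of_eq ?_) h2)
    congr 1
    ext i j
    simp [(Submodule.Quotient.mk_eq_zero I).2 (hB i j)]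
  · intro h n A
    apply le_antisymm
    · exact isCompleteContraction_mkQ I n (A.map fun v => (v : H →L[ℂ] H))
    · refine le_mnorm_quotient fun B hB => ?_
      have h1 := h n (A.map fun v => (v : H →L[ℂ] H)) (B - A.map fun v => (v : H →L[ℂ] H))
        (fun i j => (A i j).2) (fun i j => by
          have := congrFun (congrFun hB i) j
          simp only [Matrix.map_apply, LinearMap.comp_apply, Submodule.subtype_apply] at this
          rw [← sub_eq_zero, ← map_sub, Submodule.mkQ_apply, Submodule.Quotient.mk_eq_zero] at this
          exact this)
      rw [add_sub_cancel] at h1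
      exact h1

end Quotient

/-! ### Averaging over the powers of a contraction -/

/-- If `M` is a contraction, `M A = A` and `M Y = 0`, then adding `Y` and a coboundary `M C - C`
to `A` does not decrease its seminorm. -/
theorem Seminorm.le_add_coboundary {E : Type*} [AddCommGroup E] [Module ℂ E] (p : Seminorm ℂ E)
    {M : E →ₗ[ℂ] E} (hM : ∀ a, p (M a) ≤ p a) {A Y : E} (hA : M A = A) (hY : M Y = 0) (C : E) :
    p A ≤ p (A + (Y + (M C - C))) := by
  set D := A + (Y + (M C - C)) with hD
  have hpow : ∀ (k : ℕ) (a : E), p ((M ^ k) a) ≤ p a := by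
    intro k a
    induction k with
    | zero => simp
    | succ k ih => rw [pow_succ', Module.End.mul_apply]; exact (hM _).trans ih
  have hAk : ∀ k : ℕ, (M ^ k) A = A := by
    intro k
    induction k with
    | zero => simp
    | succ k ih => rw [pow_succ', Module.End.mul_apply, ih, hA]
  have hDk : ∀ k : ℕ, (M ^ (k + 1)) D = A + ((M ^ (k + 2)) C - (M ^ (k + 1)) C) := by
    intro k
    have h1 : (M ^ (k + 1)) Y = 0 := by rw [pow_succ, Module.End.mul_apply, hY, map_zero]
    have h2 : (M ^ (k + 1)) (M C) = (M ^ (k + 2)) C := by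
      rw [pow_succ M (k + 1), Module.End.mul_apply]
    rw [hD, map_add, map_add, map_sub, hAk, h1, h2, zero_add]
  -- The sum of `M ^ k D` for `1 ≤ k ≤ N` telescopes; starting at `k = 1` removes `Y`. Dividing by
  -- `N` then makes the coboundary negligible.
  have hsum : ∀ N : ℕ, p ((N : ℂ) • A + ((M ^ (N + 1)) C - M C)) ≤ N * p D := by
    intro N
    induction N with
    | zero => simp
    | succ N ih =>
      have e : ((N + 1 : ℕ) : ℂ) • A + ((M ^ (N + 1 + 1)) C - M C) =
          ((N : ℂ) • A + ((M ^ (N + 1)) C - M C)) + (M ^ (N + 1)) D := by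
        rw [hDk]
        push_cast
        module
      rw [e]
      push_cast
      linarith [map_add_le_add p ((N : ℂ) • A + ((M ^ (N + 1)) C - M C)) ((M ^ (N + 1)) D),
        hpow (N + 1) D]
  by_contra! hlt
  obtain ⟨N, hN⟩ := exists_nat_gt (2 * p C / (p A - p D))
  rw [div_lt_iff₀ (sub_pos.2 hlt)] at hN
  have h1 : p ((N : ℂ) • A) ≤ p ((N : ℂ) • A + ((M ^ (N + 1)) C - M C)) +
      p ((M ^ (N + 1)) C - M C) := by
    have := map_sub_le_add p ((N : ℂ) • A + ((M ^ (N + 1)) C - M C)) ((M ^ (N + 1)) C - M C)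
    rwa [add_sub_cancel_right] at this
  have h2 := map_sub_le_add p ((M ^ (N + 1)) C) (M C)
  have h3 : p ((N : ℂ) • A) = N * p A := by rw [map_smul_eq_mul]; simp
  linarith [hpow (N + 1) C, hM C, hsum N]

/-! ### Boundary subsystems and their quotients -/

section Boundary

variable {H : Type u} [NormedAddCommGroup H] [InnerProductSpace ℂ H]

/-- The norm of `M_n(B(H))` as a seminorm. -/
noncomputable def blockSeminorm (H : Type*) [NormedAddCommGroup H] [InnerProductSpace ℂ H] (n : ℕ) :
    Seminorm ℂ (Matrix (Fin n) (Fin n) (H →L[ℂ] H)) :=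
  Seminorm.of (fun T => ‖blockOp T‖) norm_blockOp_add_le fun c T => norm_blockOp_smul c T

variable [CompleteSpace H] {X I : Submodule ℂ (H →L[ℂ] H)}

/-- The finitely many entries of a matrix over the union already lie in one member of the chain. -/
theorem isBoundarySubsystem_sSup {c : Set (Submodule ℂ (H →L[ℂ] H))} (hne : c.Nonempty)
    (hc : IsChain (· ≤ ·) c) (hb : ∀ I ∈ c, IsBoundarySubsystem X I) :
    IsBoundarySubsystem X (sSup c) := by
  have hmem : ∀ a, a ∈ sSup c ↔ ∃ I ∈ c, a ∈ I := fun a =>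
    Submodule.mem_sSup_of_directed hne hc.directedOn
  refine ⟨fun a ha => ?_, isCompleteIsometry_mkQ_comp_subtype_iff.2 fun n A B hA hB => ?_⟩
  · obtain ⟨I, hI, haI⟩ := (hmem a).1 ha
    exact (hmem _).2 ⟨I, hI, (hb I hI).1 a haI⟩
  · choose f hfc hf using fun i j => (hmem _).1 (hB i j)
    have : Nonempty c := hne.to_subtype
    obtain ⟨z, hz⟩ := (directedOn_iff_directed.1 hc.directedOn).finite_le
      (fun ij : Fin n × Fin n => (⟨f ij.1 ij.2, hfc _ _⟩ : c))
    exact isCompleteIsometry_mkQ_comp_subtype_iff.1 (hb z z.2).2 n A B hA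
      fun i j => hz (i, j) (hf i j)

theorem isBoundarySubsystem_bot : IsBoundarySubsystem X ⊥ := by
  refine ⟨fun a ha => ?_, isCompleteIsometry_mkQ_comp_subtype_iff.2 fun n A B hA hB => ?_⟩
  · rw [Submodule.mem_bot] at ha ⊢
    rw [ha, star_zero]
  · have : B = 0 := by
      ext1 i j
      exact (Submodule.mem_bot ℂ).1 (hB i j)
    rw [this, add_zero]

theorem exists_isMaximalBoundarySubsystem (X : Submodule ℂ (H →L[ℂ] H)) :
    ∃ I, IsMaximalBoundarySubsystem X I :=
  zorn_le₀ {I | IsBoundarySubsystem X I} fun c hcs hc => by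
    rcases c.eq_empty_or_nonempty with rfl | hne
    · exact ⟨⊥, isBoundarySubsystem_bot, by simp⟩
    · exact ⟨sSup c, isBoundarySubsystem_sSup hne hc hcs, fun z hz => le_sSup hz⟩

/-- A ucc map on `B(H)` that fixes `X` and kills a maximal boundary subsystem is the identity modulo
that subsystem. -/
theorem IsMaximalBoundarySubsystem.map_sub_mem (hI : IsMaximalBoundarySubsystem X I)
    {χ : (H →L[ℂ] H) →ₗ[ℂ] H →L[ℂ] H} (hχ : IsUCC 1 1 χ) (hχX : ∀ x ∈ X, χ x = x)
    (hχI : ∀ y ∈ I, χ y = 0) (a : H →L[ℂ] H) : χ a - a ∈ I := by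
  -- The range of `χ - id` is selfadjoint because `χ` preserves adjoints; the norm inequality is the
  -- averaging lemma for the amplifications of `χ`.
  have hb : IsBoundarySubsystem X (I ⊔ LinearMap.range (χ - LinearMap.id)) := by
    refine ⟨fun b hb => ?_, isCompleteIsometry_mkQ_comp_subtype_iff.2 fun n A B hA hB => ?_⟩
    · obtain ⟨y, hy, _, ⟨c, rfl⟩, rfl⟩ := Submodule.mem_sup.1 hb
      rw [star_add]
      refine Submodule.add_mem_sup (hI.prop.1 y hy) ⟨star c, ?_⟩
      simp [map_star_of_unital_contraction hχ.1 hχ.2.norm_apply_le]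
    · have hB' : ∀ i j, ∃ y ∈ I, ∃ c, B i j = y + (χ c - c) := by
        intro i j
        obtain ⟨y, hy, _, ⟨c, rfl⟩, h⟩ := Submodule.mem_sup.1 (hB i j)
        exact ⟨y, hy, c, h.symm⟩
      choose Y hY C hC using hB'
      have h := (blockSeminorm H n).le_add_coboundary (M := χ.mapMatrix)
        (A := A) (Y := Matrix.of Y) (fun T => hχ.2 n T)
        (by ext1 i j; exact hχX _ (hA i j)) (by ext1 i j; exact hχI _ (hY i j)) (Matrix.of C)
      have e : B = Matrix.of Y + (χ.mapMatrix (Matrix.of C) - Matrix.of C) := by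
        ext1 i j
        exact hC i j
      rw [e]
      exact h
  exact hI.le_of_ge hb le_sup_left (Submodule.mem_sup_right ⟨a, rfl⟩)

/-- For a boundary subsystem `I` there is a ucc map on `B(H)` that fixes `X` and kills `I`. -/
theorem IsBoundarySubsystem.exists_isUCC (hI : IsBoundarySubsystem X I)
    (hX : (1 : H →L[ℂ] H) ∈ X) :
    ∃ φ : (H →L[ℂ] H) →ₗ[ℂ] H →L[ℂ] H, IsUCC 1 1 φ ∧ (∀ x ∈ X, φ x = x) ∧ ∀ y ∈ I, φ y = 0 := by
  -- Complete contractivity of `x + y ↦ x`, written on `X × I`. Its case `n = 1` also yields `X ∩ I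
  -- = 0`, which makes the sum map injective.
  have hle : ∀ (n : ℕ) (A : Matrix (Fin n) (Fin n) (X × I)),
      ‖blockOp (A.map (fun v => (X.subtype ∘ₗ LinearMap.fst ℂ X I) v))‖ ≤
        ‖blockOp (A.map (fun v => (X.subtype.coprod I.subtype) v))‖ := by
    intro n A
    have h := isCompleteIsometry_mkQ_comp_subtype_iff.1 hI.2 n (A.map fun v => (v.1 : H →L[ℂ] H))
      (A.map fun v => (v.2 : H →L[ℂ] H)) (fun i j => (A i j).1.2) (fun i j => (A i j).2.2)
    refine h.trans (le_of_eq ?_)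
    congr 2
  have hinj : Function.Injective (X.subtype.coprod I.subtype) := by
    rw [injective_iff_map_eq_zero]
    rintro ⟨x, y⟩ hxy
    have h := hle 1 (Matrix.of fun _ _ => (x, y))
    change ‖blockOp (Matrix.of fun _ _ : Fin 1 => (x : H →L[ℂ] H))‖ ≤
      ‖blockOp (Matrix.of fun _ _ : Fin 1 => X.subtype.coprod I.subtype (x, y))‖ at h
    rw [norm_blockOp_fin_one, norm_blockOp_fin_one, hxy, norm_zero, norm_le_zero_iff] at h
    have hx : x = 0 := Subtype.ext h
    subst hx
    have hy : y = 0 := Subtype.ext (by simpa using hxy)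
    rw [hy]
    rfl
  obtain ⟨φ, hφ, hφj⟩ := exists_completeContraction_extension hinj hle
  have hφX : ∀ x ∈ X, φ x = x := fun x hx => by simpa using hφj (⟨x, hx⟩, 0)
  exact ⟨φ, ⟨hφX 1 hX, hφ⟩, hφX, fun y hy => by simpa using hφj (0, ⟨y, hy⟩)⟩

/-- A maximal boundary subsystem has a ucc section of the quotient map that restores `X`. -/
theorem IsMaximalBoundarySubsystem.exists_section (hI : IsMaximalBoundarySubsystem X I)
    (hX : (1 : H →L[ℂ] H) ∈ X) :
    ∃ s : ((H →L[ℂ] H) ⧸ I) →ₗ[ℂ] H →L[ℂ] H, IsUCC (I.mkQ 1) 1 s ∧ (∀ x ∈ X, s (I.mkQ x) = x) ∧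
      ∀ e, I.mkQ (s e) = e := by
  obtain ⟨φ, hφ, hφX, hφI⟩ := hI.prop.exists_isUCC hX
  refine ⟨I.liftQ φ hφI, ⟨hφ.1, isCompleteContraction_of_comp_mkQ fun n A => hφ.2 n A⟩, hφX,
    fun e => ?_⟩
  obtain ⟨a, rfl⟩ := I.mkQ_surjective e
  exact (Submodule.Quotient.eq I).2 (hI.map_sub_mem hφ hφX hφI a)

/-- Two complete contractions with `q ∘ s = id` force `s` to be completely isometric, so `s` embeds
the quotient in `B(H)`. -/
theorem isUnitalOperatorSpace_quotient {s : ((H →L[ℂ] H) ⧸ I) →ₗ[ℂ] H →L[ℂ] H}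
    (hs : IsUCC (I.mkQ 1) 1 s) (hqs : ∀ e, I.mkQ (s e) = e) :
    IsUnitalOperatorSpace ((H →L[ℂ] H) ⧸ I) (I.mkQ 1) := by
  refine ⟨H, inferInstance, inferInstance, inferInstance, s,
    Function.LeftInverse.injective hqs, hs.1, fun n A => (hs.2 n A).antisymm ?_⟩
  have h := isCompleteContraction_mkQ I n (A.map fun v => s v)
  have e : (A.map fun v => s v).map (fun v => I.mkQ v) = A := by
    ext i j
    exact hqs _
  rwa [e] at h

/-- A map into the quotient is lifted by `s`, extended by Wittstock's theorem and pushed down again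
by `q`. -/
theorem isInjectiveSpace_quotient {s : ((H →L[ℂ] H) ⧸ I) →ₗ[ℂ] H →L[ℂ] H}
    (hs : IsUCC (I.mkQ 1) 1 s) (hqs : ∀ e, I.mkQ (s e) = e) :
    IsInjectiveSpace ((H →L[ℂ] H) ⧸ I) (I.mkQ 1) := by
  intro Y _ _ _ y hY Z hZ φ hφ
  obtain ⟨K, _, _, _, j, hj, hj1, hjn⟩ := hY
  obtain ⟨Ψ, hΨ, hΨj⟩ := exists_completeContraction_extension (j := j ∘ₗ Z.subtype) (φ := s ∘ₗ φ)
    (hj.comp Subtype.val_injective)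
    (fun n A => ((hs.2.comp hφ.2) n A).trans (hjn n (A.map fun z => (z : Y))).ge)
  have hΨφ : ∀ z : Z, I.mkQ (Ψ (j z)) = φ z := fun z => by
    have h := hΨj z
    simp only [LinearMap.comp_apply, Submodule.subtype_apply] at h
    rw [h, hqs]
  refine ⟨I.mkQ ∘ₗ Ψ ∘ₗ j, ⟨?_, (isCompleteContraction_mkQ I).comp
    (hΨ.comp (IsCompleteIsometry.isCompleteContraction hjn))⟩, hΨφ⟩
  exact (hΨφ ⟨y, hZ⟩).trans hφ.1

/-- The map `s ∘ θ ∘ q` is ucc, fixes `X` and kills `I`, so it is the identity modulo `I`; applying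
`q` leaves `θ = id`. -/
theorem IsMaximalBoundarySubsystem.isRigid (hI : IsMaximalBoundarySubsystem X I)
    {s : ((H →L[ℂ] H) ⧸ I) →ₗ[ℂ] H →L[ℂ] H} (hs : IsUCC (I.mkQ 1) 1 s)
    (hsX : ∀ x ∈ X, s (I.mkQ x) = x) (hqs : ∀ e, I.mkQ (s e) = e) :
    IsRigid (I.mkQ 1) (I.mkQ ∘ₗ X.subtype) := by
  intro θ hθ hθX
  have hχX : ∀ x ∈ X, (s ∘ₗ θ ∘ₗ I.mkQ) x = x := fun x hx => by
    have h := hθX ⟨x, hx⟩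
    simp only [LinearMap.comp_apply, Submodule.subtype_apply] at h ⊢
    rw [h, hsX x hx]
  have h := hI.map_sub_mem (χ := s ∘ₗ θ ∘ₗ I.mkQ)
    ⟨by simp only [LinearMap.comp_apply, hθ.1, hs.1],
      hs.2.comp (hθ.2.comp (isCompleteContraction_mkQ I))⟩ hχX
    (fun y hy => by
      simp only [LinearMap.comp_apply, Submodule.mkQ_apply,
        (Submodule.Quotient.mk_eq_zero I).2 hy, map_zero])
  ext e
  have h1 := (Submodule.Quotient.eq I).2 (h e)
  exact (hqs _).symm.trans h1

end Boundary

/-- A rigid injective extension is an injective envelope. -/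
theorem IsRigid.isInjectiveEnvelope {X E : Type u} [AddCommGroup X] [Module ℂ X] [MatrixNorms X]
    [AddCommGroup E] [Module ℂ E] [MatrixNorms E] {x₀ : X} {e : E} {ι : X →ₗ[ℂ] E}
    (hr : IsRigid e ι) (hE : IsExtension x₀ e ι) (hi : IsInjectiveSpace E e) :
    IsInjectiveEnvelope x₀ e ι := by
  refine ⟨hE, hi, fun F he hF hFi => ?_⟩
  -- Injectivity of `F` extends its identity to a ucc map `E → F`. Rigidity makes this map the
  -- identity of `E`, so `F` is everything.
  obtain ⟨ψ, hψ, hψF⟩ := hFi E e hE.1 F he LinearMap.id ⟨rfl, fun n A => le_rfl⟩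
  have h := hr (F.subtype ∘ₗ ψ) ⟨by simp [hψ.1], fun n A => hψ.2 n A⟩ (fun x => by
    have := hψF ⟨ι x, hF ⟨x, rfl⟩⟩
    simp only [LinearMap.comp_apply, this]
    rfl)
  rw [eq_top_iff]
  intro a _
  have := LinearMap.congr_fun h a
  simp only [LinearMap.comp_apply, LinearMap.id_apply] at this
  rw [← this]
  exact (ψ a).2

theorem mainTheorem2 {H : Type u} [NormedAddCommGroup H] [InnerProductSpace ℂ H] [CompleteSpace H]
    (X : Submodule ℂ (H →L[ℂ] H)) (hX : (1 : H →L[ℂ] H) ∈ X) :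
    (∃ I : Submodule ℂ (H →L[ℂ] H), IsMaximalBoundarySubsystem X I) ∧
    ∀ I : Submodule ℂ (H →L[ℂ] H), IsMaximalBoundarySubsystem X I →
      IsInjectiveEnvelope (⟨1, hX⟩ : X) (I.mkQ 1) (I.mkQ ∘ₗ X.subtype) ∧
      IsRigid (I.mkQ 1) (I.mkQ ∘ₗ X.subtype) := by
  refine ⟨exists_isMaximalBoundarySubsystem X, fun I hI => ?_⟩
  obtain ⟨s, hs, hsX, hqs⟩ := hI.exists_section hX
  have hr := hI.isRigid hs hsX hqs
  exact ⟨hr.isInjectiveEnvelope ⟨isUnitalOperatorSpace_quotient hs hqs, rfl, hI.prop.2⟩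
    (isInjectiveSpace_quotient hs hqs), hr⟩
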